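/- Let $K\subset\mathbb{R}^n$ be a convex body (a compact convex set) with non-empty interior. Let $g:K\longrightarrow\mathbb{R}_{\geq 0}$ be a concave function, let $p\in(0,\infty)$, and let $f:K\longrightarrow\mathbb{R}_{\geq 0}$ be a $p$-concave function, that is, \[ f\bigl((1-\lambda)x+\lambda y\bigr)\geq\bigl((1-\lambda)f(x)^p+\lambda f(y)^p\bigr)^{1/p} \] for all $x,y\in K$ with $f(x)f(y)>0$ and all $\lambda\in(0,1)$; assume that $f>0$ on the interior of $K$. Then $f$ and $x\mapsto f(x)\,x$ are integrable on $K$, $\int_K f(x)\,\mathrm{d}x>0$, the point $\frac{\int_K x f(x)\,\mathrm{d}x}{\int_K f(x)\,\mathrm{d}x}$ belongs to $K$, $\|g\|_\infty:=\sup_{x\in K}|g(x)|$ is finite, and \[ g\left(\frac{\int_{K} x f(x)\,\mathrm{d}x}{\int_{K} f(x)\,\mathrm{d}x}\right)\geq\left(\frac{p}{(n+1)p+1}\right)\|g\|_{\infty}. \] -/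

import Mathlib

open MeasureTheory

noncomputable section

/-- `f` is `p`-concave on `K` (for a real exponent `p`): the `p`-mean inequality holds along
segments joining points of `K` at which `f` does not vanish. -/
def PConcaveOn {n : ℕ} (p : ℝ) (K : Set (EuclideanSpace ℝ (Fin n)))
    (f : EuclideanSpace ℝ (Fin n) → ℝ) : Prop :=
  ∀ x ∈ K, ∀ y ∈ K, 0 < f x * f y → ∀ t ∈ Set.Ioo (0 : ℝ) 1,
    ((1 - t) * f x ^ p + t * f y ^ p) ^ (1 / p) ≤ f ((1 - t) • x + t • y)

/-- The barycenter of `K` with respect to the weight `f`. -/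
def weightedBarycenter {n : ℕ} (K : Set (EuclideanSpace ℝ (Fin n)))
    (f : EuclideanSpace ℝ (Fin n) → ℝ) : EuclideanSpace ℝ (Fin n) :=
  (∫ x in K, f x)⁻¹ • ∫ x in K, f x • x

/-- The supremum norm of `g` on `K`. -/
def supNormOn {n : ℕ} (K : Set (EuclideanSpace ℝ (Fin n)))
    (g : EuclideanSpace ℝ (Fin n) → ℝ) : ℝ :=
  sSup ((fun x => |g x|) '' K)

end

/-! Weight the interior `U` of `K` by the measure `ν` with density `f`. Jensen bounds `g` at the
barycenter below by the `ν`-mean of `g`, so it suffices to bound this mean by a multiple of `M = g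
x₀` for each `x₀ ∈ U`. Since `g ≥ 0` is concave, `{g ≥ t}` contains the copy of `U` shrunk about
`x₀` by the ratio `s = 1 - t / M`. Concavity of `f ^ p` costs at most a factor `s ^ (1 / p)` under
this shrinking and the Jacobian gives `s ^ n`, so the copy carries at least the proportion `s ^ (n +
1 / p)` of the mass. Integrating over `t` gives the mean at least `M / (n + 1 / p + 1)`, which is
the stated constant. Working on `U` gives continuity of `f` and `g`; the frontier of `K` is null,
and boundary values of `g` are recovered along segments. -/

open Set Filter Topology

section Concave

variable {E : Type*} [NormedAddCommGroup E] [NormedSpace ℝ E]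

/-- A nonnegative concave function on a bounded set with nonempty interior is bounded above. -/
theorem ConcaveOn.bddAbove_image_of_nonneg {s : Set E} {h : E → ℝ} (hh : ConcaveOn ℝ s h)
    (h0 : ∀ x ∈ s, 0 ≤ h x) (hs : Bornology.IsBounded s) (hint : (interior s).Nonempty) :
    BddAbove (h '' s) := by
  obtain ⟨c, hc⟩ := hint
  obtain ⟨r, hr, hball⟩ := Metric.isOpen_iff.1 isOpen_interior c hc
  obtain ⟨R, hR, hsR⟩ := hs.subset_ball_lt 0 c
  -- Reflecting `x` through `c` with this factor stays in the ball about `c`, so `c` is a convex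
  -- combination of `x` and a point of `s`.
  set δ : ℝ := r / R with hδ
  have hδ0 : 0 < δ := div_pos hr hR
  refine ⟨(1 + δ) / δ * h c, ?_⟩
  rintro _ ⟨x, hx, rfl⟩
  have hxR : ‖x - c‖ < R := by simpa [dist_eq_norm] using hsR hx
  have hy : c - δ • (x - c) ∈ s := by
    refine interior_subset (hball ?_)
    rw [Metric.mem_ball, dist_eq_norm, sub_sub_cancel_left, norm_neg, norm_smul,
      Real.norm_of_nonneg hδ0.le]
    calc δ * ‖x - c‖ < δ * R := by gcongr
      _ = r := by rw [hδ]; field_simp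
  have key := hh.2 hx hy (show 0 ≤ δ / (1 + δ) by positivity)
    (show 0 ≤ 1 / (1 + δ) by positivity) (by field_simp; ring)
  have hcomb : (δ / (1 + δ)) • x + (1 / (1 + δ)) • (c - δ • (x - c)) = c := by
    have : (1 / (1 + δ) + δ / (1 + δ) : ℝ) = 1 := by field_simp
    calc _ = (1 / (1 + δ) + δ / (1 + δ) : ℝ) • c := by module
      _ = c := by rw [this, one_smul]
  rw [hcomb, smul_eq_mul, smul_eq_mul] at key
  have h1 : δ / (1 + δ) * h x ≤ h c := by
    have := mul_nonneg (by positivity : 0 ≤ 1 / (1 + δ)) (h0 _ hy)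
    linarith
  calc h x = (1 + δ) / δ * (δ / (1 + δ) * h x) := by field_simp
    _ ≤ (1 + δ) / δ * h c := by gcongr

/-- Jensen's inequality for a concave function that need not be continuous on its domain, when
the barycenter is an interior point. -/
theorem ConcaveOn.average_le_map_average_of_mem_interior [FiniteDimensional ℝ E]
    [MeasurableSpace E] {ν : Measure E} [IsFiniteMeasure ν] [NeZero ν]
    {s : Set E} {g : E → ℝ} (hg : ConcaveOn ℝ s g) (hνs : ∀ᵐ x ∂ν, x ∈ s)
    (hid : Integrable (fun x => x) ν) (hgi : Integrable g ν)
    (hb : (⨍ x, x ∂ν) ∈ interior s) : (⨍ x, g x ∂ν) ≤ g (⨍ x, x ∂ν) := by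
  set b := ⨍ x, x ∂ν
  -- The hypograph need not be closed; continuity of `g` at the interior point `b` makes its closure
  -- enough.
  have hmem : (⨍ x, (x, g x) ∂ν) ∈ closure {q : E × ℝ | q.1 ∈ s ∧ q.2 ≤ g q.1} := by
    refine hg.convex_hypograph.closure.average_mem isClosed_closure ?_ (hid.prodMk hgi)
    filter_upwards [hνs] with x hx using subset_closure ⟨hx, le_rfl⟩
  rw [average_pair hid hgi, mem_closure_iff_frequently] at hmem
  have hcont : ContinuousAt g b :=
    hg.continuousOn_interior.continuousAt (isOpen_interior.mem_nhds hb)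
  by_contra! hlt
  obtain ⟨m, hm1, hm2⟩ := exists_between hlt
  have h1 : ∀ᶠ q : E × ℝ in 𝓝 (b, ⨍ x, g x ∂ν), g q.1 < m :=
    (hcont.comp (f := Prod.fst) (x := (b, ⨍ x, g x ∂ν)) continuousAt_fst).eventually
      (eventually_lt_nhds hm1)
  have h2 : ∀ᶠ q : E × ℝ in 𝓝 (b, ⨍ x, g x ∂ν), m < q.2 :=
    continuousAt_snd.eventually (eventually_gt_nhds hm2)
  obtain ⟨q, ⟨_, hq⟩, hq1, hq2⟩ := (hmem.and_eventually (h1.and h2)).exists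
  linarith

/-- The mean of a nonnegative function whose upper level sets have at least the masses
`(1 - t / M) ^ q`. -/
theorem div_le_average_of_rpow_le_measure {α : Type*} [MeasurableSpace α] {ν : Measure α}
    [IsFiniteMeasure ν] [NeZero ν] {g : α → ℝ} (hg0 : 0 ≤ᵐ[ν] g) (hgi : Integrable g ν)
    {M q : ℝ} (hM : 0 < M) (hq : 0 ≤ q)
    (hlevel : ∀ t ∈ Ioo 0 M, ENNReal.ofReal ((1 - t / M) ^ q) * ν univ ≤ ν {x | t ≤ g x}) :
    M / (q + 1) ≤ ⨍ x, g x ∂ν := by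
  have hint : ∫ t in (0 : ℝ)..M, (1 - t / M) ^ q = M / (q + 1) := by
    rw [intervalIntegral.integral_comp_sub_div (fun u => u ^ q) hM.ne', div_self hM.ne', sub_self,
      zero_div, sub_zero, integral_rpow (Or.inl (by linarith)), Real.one_rpow,
      Real.zero_rpow (by linarith)]
    simp [div_eq_mul_inv]
  have hcont : Continuous fun t : ℝ => (1 - t / M) ^ q :=
    (continuous_const.sub (continuous_id.div_const M)).rpow_const fun _ => Or.inr hq
  -- Layer-cake formula, keeping only the levels in `(0, M)`.
  have hlow : ENNReal.ofReal (M / (q + 1)) * ν univ ≤ ∫⁻ x, ENNReal.ofReal (g x) ∂ν := by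
    rw [lintegral_eq_lintegral_meas_le ν hg0 hgi.aemeasurable, ← hint,
      intervalIntegral.integral_of_le hM.le, integral_Ioc_eq_integral_Ioo,
      ofReal_integral_eq_lintegral_ofReal
        (hcont.integrableOn_Icc.mono_set Ioo_subset_Icc_self), ← lintegral_mul_const']
    · calc _ ≤ ∫⁻ t in Ioo 0 M, ν {x | t ≤ g x} := setLIntegral_mono' measurableSet_Ioo hlevel
        _ ≤ _ := lintegral_mono_set Ioo_subset_Ioi_self
    · exact measure_ne_top _ _
    · refine (ae_restrict_mem measurableSet_Ioo).mono fun t ht => Real.rpow_nonneg ?_ q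
      rw [sub_nonneg, div_le_one hM]
      exact ht.2.le
  rw [← ofReal_integral_eq_lintegral_ofReal hgi hg0, ← ofReal_measureReal,
    ← ENNReal.ofReal_mul (by positivity),
    ENNReal.ofReal_le_ofReal_iff (integral_nonneg_of_ae hg0)] at hlow
  have hpos : 0 < ν.real univ := measureReal_univ_pos
  rw [average_eq, smul_eq_mul, inv_mul_eq_div, le_div_iff₀ hpos]
  exact hlow

/-- A nonnegative function with concave `p`-th power decays along rays at most like a homogeneous
function of degree `1 / p`. -/
theorem ConcaveOn.rpow_mul_le_homothety {U : Set E} {f : E → ℝ} {p : ℝ} (hp : 0 < p)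
    (hf : ConcaveOn ℝ U fun x => f x ^ p) (hf0 : ∀ x ∈ U, 0 ≤ f x) {x₀ x : E} (hx₀ : x₀ ∈ U)
    (hx : x ∈ U) {s : ℝ} (hs0 : 0 ≤ s) (hs1 : s ≤ 1) :
    s ^ (1 / p) * f x ≤ f (AffineMap.homothety x₀ s x) := by
  have hcomb : AffineMap.homothety x₀ s x = s • x + (1 - s) • x₀ := by
    rw [AffineMap.homothety_apply, vsub_eq_sub, vadd_eq_add]
    module
  have hmem : AffineMap.homothety x₀ s x ∈ U := by
    rw [hcomb]
    exact hf.1 hx hx₀ hs0 (sub_nonneg.2 hs1) (by ring)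
  have key := hf.2 hx hx₀ hs0 (sub_nonneg.2 hs1) (by ring)
  rw [← hcomb, smul_eq_mul, smul_eq_mul] at key
  have h1 : s * f x ^ p ≤ f (AffineMap.homothety x₀ s x) ^ p := by
    have := mul_nonneg (sub_nonneg.2 hs1) (Real.rpow_nonneg (hf0 x₀ hx₀) p)
    linarith
  rwa [← Real.rpow_le_rpow_iff (mul_nonneg (Real.rpow_nonneg hs0 _) (hf0 x hx)) (hf0 _ hmem) hp,
    Real.mul_rpow (Real.rpow_nonneg hs0 _) (hf0 x hx), ← Real.rpow_mul hs0,
    one_div_mul_cancel hp.ne', Real.rpow_one]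

variable [FiniteDimensional ℝ E]

theorem ConcaveOn.continuousOn_of_rpow {U : Set E} (hU : IsOpen U) {f : E → ℝ} {p : ℝ}
    (hp : 0 < p) (hf : ConcaveOn ℝ U fun x => f x ^ p) (hf0 : ∀ x ∈ U, 0 ≤ f x) :
    ContinuousOn f U := by
  refine ((hf.continuousOn hU).rpow_const (p := 1 / p) fun x _ =>
    Or.inr (by positivity)).congr fun x hx => ?_
  dsimp only
  rw [← Real.rpow_mul (hf0 x hx), mul_one_div_cancel hp.ne', Real.rpow_one]

variable [MeasurableSpace E] [BorelSpace E]
  {μ : Measure E} [μ.IsAddHaarMeasure]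

/-- If `f` decays along rays issuing from `x₀` at least like a homogeneous function of degree `m`,
then homothetic copies of `U` with centre `x₀` and ratio `s` carry at least the proportion
`s ^ (dim E + m)` of the mass of `f`. -/
theorem rpow_mul_lintegral_le_lintegral_homothety_image {U : Set E} (hU : MeasurableSet U)
    {f : E → ℝ} {x₀ : E} {s m : ℝ} (hs : 0 < s)
    (hf : ∀ x ∈ U, s ^ m * f x ≤ f (AffineMap.homothety x₀ s x)) :
    ENNReal.ofReal (s ^ (Module.finrank ℝ E + m)) * ∫⁻ x in U, ENNReal.ofReal (f x) ∂μ ≤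
      ∫⁻ x in AffineMap.homothety x₀ s '' U, ENNReal.ofReal (f x) ∂μ := by
  have hderiv : ∀ x ∈ U, HasFDerivWithinAt (AffineMap.homothety x₀ s)
      (s • ContinuousLinearMap.id ℝ E) U x := by
    intro x _
    have h : HasFDerivAt (fun y : E => s • (y - x₀) + x₀) (s • ContinuousLinearMap.id ℝ E) x :=
      (((hasFDerivAt_id x).sub_const x₀).const_smul s).add_const x₀
    exact h.hasFDerivWithinAt
  have hinj : InjOn (AffineMap.homothety x₀ s) U := fun x _ y _ hxy => by
    simpa [AffineMap.homothety_apply, hs.ne'] using hxy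
  rw [lintegral_image_eq_lintegral_abs_det_fderiv_mul μ hU hderiv hinj,
    ← lintegral_const_mul' _ _ ENNReal.ofReal_ne_top]
  refine setLIntegral_mono' hU fun x hx => ?_
  have hdet : (s • ContinuousLinearMap.id ℝ E).det = s ^ Module.finrank ℝ E := by
    simp [ContinuousLinearMap.det, LinearMap.det_smul]
  rw [hdet, abs_of_pos (by positivity), Real.rpow_add hs, Real.rpow_natCast,
    ENNReal.ofReal_mul (by positivity), mul_assoc, ← ENNReal.ofReal_mul (by positivity)]
  gcongr
  exact hf x hx


/-- A nonnegative function with concave `p`-th power is integrable on a bounded open set. -/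
theorem ConcaveOn.integrableOn_of_rpow {U : Set E} (hU : IsOpen U) (hUne : U.Nonempty)
    (hUb : Bornology.IsBounded U) {f : E → ℝ} {p : ℝ} (hp : 0 < p)
    (hf : ConcaveOn ℝ U fun x => f x ^ p) (hf0 : ∀ x ∈ U, 0 ≤ f x) : IntegrableOn f U μ := by
  obtain ⟨C, hC⟩ := hf.bddAbove_image_of_nonneg (fun x hx => Real.rpow_nonneg (hf0 x hx) p) hUb
    (by rwa [hU.interior_eq])
  refine IntegrableOn.of_bound (hUb.measure_lt_top)
    ((hf.continuousOn_of_rpow hU hp hf0).aestronglyMeasurable hU.measurableSet) (C ^ (1 / p)) ?_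
  refine (ae_restrict_mem hU.measurableSet).mono fun x hx => ?_
  rw [Real.norm_of_nonneg (hf0 x hx)]
  calc f x = (f x ^ p) ^ (1 / p) := by
        rw [← Real.rpow_mul (hf0 x hx), mul_one_div_cancel hp.ne', Real.rpow_one]
    _ ≤ C ^ (1 / p) := Real.rpow_le_rpow (Real.rpow_nonneg (hf0 x hx) p)
        (hC ⟨x, hx, rfl⟩) (by positivity)

/-- The barycenter of a finite measure carried by a convex open set and charging each of its
nonempty open subsets lies in the set. -/
theorem Convex.average_mem_of_isOpen {U : Set E} (hUc : Convex ℝ U) (hU : IsOpen U)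
    (hUne : U.Nonempty) {ν : Measure E} [IsFiniteMeasure ν] (hνU : ∀ᵐ x ∂ν, x ∈ U)
    (hpos : ∀ V ⊆ U, IsOpen V → V.Nonempty → ν V ≠ 0) (hid : Integrable (fun x => x) ν) :
    (⨍ x, x ∂ν) ∈ U := by
  obtain ⟨c, hc⟩ := hUne
  obtain ⟨r, hr, hball⟩ := Metric.isOpen_iff.1 hU c hc
  -- The average over this ball stays in it, hence is interior to `U`; one such set of positive mass
  -- forces the whole average into the interior.
  have hcb : Metric.closedBall c (r / 2) ⊆ U :=
    (Metric.closedBall_subset_ball (half_lt_self hr)).trans hball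
  have h0 : ν (Metric.closedBall c (r / 2)) ≠ 0 := fun h =>
    hpos (Metric.ball c (r / 2)) (Metric.ball_subset_closedBall.trans hcb) Metric.isOpen_ball
      ⟨c, Metric.mem_ball_self (half_pos hr)⟩ (measure_mono_null Metric.ball_subset_closedBall h)
  rw [← hU.interior_eq]
  refine hUc.average_mem_interior_of_set h0 hνU hid ?_
  rw [hU.interior_eq]
  exact hcb ((convex_closedBall c (r / 2)).set_average_mem Metric.isClosed_closedBall h0
    (measure_ne_top _ _) (ae_restrict_mem Metric.isClosed_closedBall.measurableSet)
    hid.integrableOn)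

/-- On a bounded open convex set, a nonnegative concave function `g` takes at the barycenter of a
positive density with concave `p`-th power at least the proportion `1 / (dim E + 1 / p + 1)` of
each of its values. -/
theorem ConcaveOn.div_le_map_barycenter {U : Set E} (hU : IsOpen U)
    (hUb : Bornology.IsBounded U) {f g : E → ℝ} {p : ℝ} (hp : 0 < p)
    (hf : ConcaveOn ℝ U fun x => f x ^ p) (hfpos : ∀ x ∈ U, 0 < f x) (hg : ConcaveOn ℝ U g)
    (hg0 : ∀ x ∈ U, 0 ≤ g x) {x₀ : E} (hx₀ : x₀ ∈ U) :
    ((∫ x in U, f x ∂μ)⁻¹ • ∫ x in U, f x • x ∂μ) ∈ U ∧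
      g x₀ / (Module.finrank ℝ E + 1 / p + 1) ≤
        g ((∫ x in U, f x ∂μ)⁻¹ • ∫ x in U, f x • x ∂μ) := by
  have hUne : U.Nonempty := ⟨x₀, hx₀⟩
  have hf0 : ∀ x ∈ U, 0 ≤ f x := fun x hx => (hfpos x hx).le
  have hfi : IntegrableOn f U μ := hf.integrableOn_of_rpow hU hUne hUb hp hf0
  have hfm : AEMeasurable (fun x => ENNReal.ofReal (f x)) (μ.restrict U) :=
    hfi.aemeasurable.ennreal_ofReal
  have hftop : ∀ᵐ x ∂μ.restrict U, ENNReal.ofReal (f x) < ⊤ :=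
    Eventually.of_forall fun x => ENNReal.ofReal_lt_top
  have haeU : ∀ᵐ x ∂μ.restrict U, x ∈ U := ae_restrict_mem hU.measurableSet
  set ν : Measure E := (μ.restrict U).withDensity fun x => ENNReal.ofReal (f x) with hν
  have hνac : ν ≪ μ.restrict U := withDensity_absolutelyContinuous _ _
  have hνU : ∀ᵐ x ∂ν, x ∈ U := hνac.ae_le haeU
  have hνV : ∀ V ⊆ U, MeasurableSet V → ν V = ∫⁻ x in V, ENNReal.ofReal (f x) ∂μ := by
    intro V hVU hV
    rw [hν, withDensity_apply _ hV, Measure.restrict_restrict_of_subset hVU]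
  have hνuniv : ν univ = ∫⁻ x in U, ENNReal.ofReal (f x) ∂μ := by
    rw [hν, withDensity_apply _ MeasurableSet.univ, Measure.restrict_univ]
  have hpos : ∀ V ⊆ U, IsOpen V → V.Nonempty → ν V ≠ 0 := by
    intro V hVU hV hVne h
    rw [hνV V hVU hV.measurableSet, setLIntegral_eq_zero_iff' hV.measurableSet
      (hfm.mono_measure (Measure.restrict_mono_set μ hVU))] at h
    refine (hV.measure_pos μ hVne).ne' (measure_mono_null (fun x hx => ?_) h)
    simpa using ⟨hx, hfpos x (hVU hx)⟩
  have : IsFiniteMeasure ν := isFiniteMeasure_withDensity_ofReal hfi.2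
  have : NeZero ν := ⟨fun h => hpos U subset_rfl hU hUne (by simp [h])⟩
  obtain ⟨R, hR⟩ := hUb.exists_norm_le
  have hid : Integrable (fun x => x) ν :=
    Integrable.of_bound aestronglyMeasurable_id R (hνU.mono hR)
  obtain ⟨C, hC⟩ := hg.bddAbove_image_of_nonneg hg0 hUb (by rwa [hU.interior_eq])
  have hgi : Integrable g ν := by
    refine Integrable.of_bound (((hg.continuousOn hU).aestronglyMeasurable
      hU.measurableSet).mono_ac hνac) C (hνU.mono fun x hx => ?_)
    rw [Real.norm_of_nonneg (hg0 x hx)]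
    exact hC ⟨x, hx, rfl⟩
  have hbary : (⨍ x, x ∂ν) = (∫ x in U, f x ∂μ)⁻¹ • ∫ x in U, f x • x ∂μ := by
    rw [average_eq, hν, integral_withDensity_eq_integral_toReal_smul₀ hfm hftop, ← hν,
      measureReal_def, hνuniv, ← ofReal_integral_eq_lintegral_ofReal hfi
        (haeU.mono hf0), ENNReal.toReal_ofReal (setIntegral_nonneg hU.measurableSet hf0)]
    congr 1
    exact integral_congr_ae (haeU.mono fun x hx => by
      simp only [ENNReal.toReal_ofReal (hf0 x hx)])
  have hmem : (⨍ x, x ∂ν) ∈ U := hg.1.average_mem_of_isOpen hU hUne hνU hpos hid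
  rw [← hbary]
  refine ⟨hmem, ?_⟩
  have hjensen : (⨍ x, g x ∂ν) ≤ g (⨍ x, x ∂ν) :=
    hg.average_le_map_average_of_mem_interior hνU hid hgi (by rwa [hU.interior_eq])
  rcases (hg0 x₀ hx₀).eq_or_lt with hM | hM
  · rw [← hM, zero_div]
    exact hg0 _ hmem
  refine le_trans (div_le_average_of_rpow_le_measure (hνU.mono hg0) hgi hM (by positivity) ?_)
    hjensen
  rintro t ⟨ht0, htM⟩
  have hs0 : 0 < 1 - t / g x₀ := by rwa [sub_pos, div_lt_one hM]
  have hs1 : 1 - t / g x₀ ≤ 1 := sub_le_self _ (by positivity)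
  have hcomb : ∀ x, AffineMap.homothety x₀ (1 - t / g x₀) x
      = (1 - t / g x₀) • x + (t / g x₀) • x₀ := by
    intro x
    rw [AffineMap.homothety_apply, vsub_eq_sub, vadd_eq_add]
    module
  have hsub : AffineMap.homothety x₀ (1 - t / g x₀) '' U ⊆ U := by
    rintro _ ⟨x, hx, rfl⟩
    rw [hcomb]
    exact hg.1 hx hx₀ hs0.le (by positivity) (by ring)
  have hopen : IsOpen (AffineMap.homothety x₀ (1 - t / g x₀) '' U) :=
    AffineMap.homothety_isOpenMap x₀ _ hs0.ne' U hU
  calc _ ≤ ν (AffineMap.homothety x₀ (1 - t / g x₀) '' U) := by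
        rw [hνuniv, hνV _ hsub hopen.measurableSet]
        exact rpow_mul_lintegral_le_lintegral_homothety_image hU.measurableSet hs0 fun x hx =>
          hf.rpow_mul_le_homothety hp hf0 hx₀ hx hs0.le hs1
    _ ≤ _ := by
        -- At ratio `1 - t / g x₀`, the point `x₀` alone contributes exactly `t` to the concavity
        -- bound.
        refine measure_mono ?_
        rintro _ ⟨x, hx, rfl⟩
        have h := hg.2 hx hx₀ hs0.le (show 0 ≤ t / g x₀ by positivity) (by ring)
        rw [← hcomb, smul_eq_mul, smul_eq_mul, div_mul_cancel₀ _ hM.ne'] at h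
        have := mul_nonneg hs0.le (hg0 x hx)
        show t ≤ g _
        linarith

end Concave

/-- Positivity on `U` rules out the pairs that `PConcaveOn` leaves unconstrained. -/
theorem PConcaveOn.concaveOn_rpow {n : ℕ} {p : ℝ} {K U : Set (EuclideanSpace ℝ (Fin n))}
    {f : EuclideanSpace ℝ (Fin n) → ℝ} (hf : PConcaveOn p K f) (hp : 0 < p) (hUK : U ⊆ K)
    (hU : Convex ℝ U) (hfpos : ∀ x ∈ U, 0 < f x) : ConcaveOn ℝ U fun x => f x ^ p := by
  refine concaveOn_iff_forall_pos.2 ⟨hU, fun x hx y hy a b ha hb hab => ?_⟩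
  have key := hf x (hUK hx) y (hUK hy) (mul_pos (hfpos x hx) (hfpos y hy)) b
    ⟨hb, by linarith⟩
  rw [show 1 - b = a by linarith] at key
  have hnn : 0 ≤ a * f x ^ p + b * f y ^ p := by
    have := hfpos x hx
    have := hfpos y hy
    positivity
  simp only [smul_eq_mul]
  calc a * f x ^ p + b * f y ^ p = ((a * f x ^ p + b * f y ^ p) ^ (1 / p)) ^ p := by
        rw [← Real.rpow_mul hnn, one_div_mul_cancel hp.ne', Real.rpow_one]
    _ ≤ _ := Real.rpow_le_rpow (Real.rpow_nonneg hnn _) key hp.le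

/-- Only the values of `f` and `g` on `K` matter. Besides the inequality, the conclusion says that
the integrals, the barycenter as an argument of `g`, and the supremum are all meaningful. -/
theorem propositionp (n : ℕ) (K : Set (EuclideanSpace ℝ (Fin n)))
    (hKcompact : IsCompact K) (hKconvex : Convex ℝ K) (hKint : (interior K).Nonempty)
    (g : EuclideanSpace ℝ (Fin n) → ℝ) (hg0 : ∀ x ∈ K, 0 ≤ g x) (hg : ConcaveOn ℝ K g)
    (p : ℝ) (hp : 0 < p)
    (f : EuclideanSpace ℝ (Fin n) → ℝ) (hf0 : ∀ x ∈ K, 0 ≤ f x) (hf : PConcaveOn p K f)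
    (hfpos : ∀ x ∈ interior K, 0 < f x) :
    IntegrableOn f K ∧ IntegrableOn (fun x => f x • x) K ∧ 0 < ∫ x in K, f x ∧
      weightedBarycenter K f ∈ K ∧
      BddAbove ((fun x => |g x|) '' K) ∧
      p / (((n : ℝ) + 1) * p + 1) * supNormOn K g ≤ g (weightedBarycenter K f) := by
  have hUK : interior K ⊆ K := interior_subset
  have hU : IsOpen (interior K) := isOpen_interior
  have hUb : Bornology.IsBounded (interior K) := hKcompact.isBounded.subset hUK
  have hae : interior K =ᵐ[volume] K :=
    interior_ae_eq_of_null_frontier (hKconvex.addHaar_frontier volume)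
  have hfU : ConcaveOn ℝ (interior K) fun x => f x ^ p :=
    hf.concaveOn_rpow hp hUK hKconvex.interior hfpos
  have hgU : ConcaveOn ℝ (interior K) g := hg.subset hUK hKconvex.interior
  have hfiU : IntegrableOn f (interior K) :=
    hfU.integrableOn_of_rpow hU hKint hUb hp fun x hx => (hfpos x hx).le
  have hfi : IntegrableOn f K := hfiU.congr_set_ae hae.symm
  have hfxi : IntegrableOn (fun x => f x • x) K :=
    hfi.smul_continuousOn continuousOn_id hKcompact
  have hfint : 0 < ∫ x in K, f x := by
    rw [← setIntegral_congr_set hae]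
    refine (setIntegral_pos_iff_support_of_nonneg_ae
      ((ae_restrict_mem hU.measurableSet).mono fun x hx => (hfpos x hx).le) hfiU).2 ?_
    refine (hU.measure_pos volume hKint).trans_le (measure_mono fun x hx => ?_)
    exact ⟨(hfpos x hx).ne', hx⟩
  have hbary : weightedBarycenter K f
      = (∫ x in interior K, f x)⁻¹ • ∫ x in interior K, f x • x := by
    rw [weightedBarycenter, setIntegral_congr_set hae, setIntegral_congr_set hae]
  have hmain := fun x₀ (hx₀ : x₀ ∈ interior K) =>
    hfU.div_le_map_barycenter (μ := volume) hU hUb hp hfpos hgU (fun x hx => hg0 x (hUK hx)) hx₀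
  simp only [← hbary, finrank_euclideanSpace_fin] at hmain
  obtain ⟨c, hc⟩ := hKint
  have habs : (fun x => |g x|) '' K = g '' K := image_congr fun x hx => abs_of_nonneg (hg0 x hx)
  refine ⟨hfi, hfxi, hfint, hUK (hmain c hc).1, ?_, ?_⟩
  · rw [habs]
    exact hg.bddAbove_image_of_nonneg hg0 hKcompact.isBounded ⟨c, hc⟩
  have hcoef : p / (((n : ℝ) + 1) * p + 1) = ((n : ℝ) + 1 / p + 1)⁻¹ := by
    field_simp
    ring
  rw [hcoef, inv_mul_le_iff₀ (by positivity), supNormOn, habs]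
  refine csSup_le ((nonempty_of_mem (hUK hc)).image g) ?_
  rintro _ ⟨x, hx, rfl⟩
  -- `x` may lie on the frontier, where `g` can jump: apply the interior bound at `(1 - t) • x + t •
  -- c`, where `g` is at least `(1 - t) * g x`, and let `t` tend to `0`.
  have hlim : Tendsto (fun t : ℝ => (1 - t) * g x) (𝓝[>] 0) (𝓝 (g x)) := by
    have : Tendsto (fun t : ℝ => (1 - t) * g x) (𝓝 0) (𝓝 ((1 - 0) * g x)) :=
      Continuous.tendsto (by fun_prop) 0
    rw [sub_zero, one_mul] at this
    exact this.mono_left nhdsWithin_le_nhds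
  refine le_of_tendsto hlim ?_
  filter_upwards [Ioo_mem_nhdsGT (zero_lt_one' ℝ)] with t ht
  have ht1 : 0 ≤ 1 - t := sub_nonneg.2 ht.2.le
  have hmem : (1 - t) • x + t • c ∈ interior K :=
    hKconvex.combo_self_interior_mem_interior hx hc ht1 ht.1 (by ring)
  have h1 := hg.2 hx (hUK hc) ht1 ht.1.le (by ring)
  have h2 := mul_nonneg ht.1.le (hg0 c (hUK hc))
  have h3 := (hmain _ hmem).2
  rw [div_le_iff₀' (by positivity)] at h3
  simp only [smul_eq_mul] at h1
  linarith
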